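/- Let $q$ be a prime power, $h\ge 2$, $k\ge 3$, and let $1\le u_0<u_1\le\cdots\le u_h$ be integers with $h\le q$, $k\ge\sum_{i=1}^h u_i-(h-1)u_0$, $q^k-q^{k-1}>q^{u_0}-1+\sum_{i=1}^h(q^{u_i}-q^{u_0})$ and $u_1>(h-1)\frac{q^{u_0}-1}{q-1}$. Let $e_1,\dots,e_k$ be the standard basis of $\mathbf F_q^k$. For $1\le i\le h$ let $U_i\subset\mathbf F_q^k$ be the subspace spanned by $e_1,\dots,e_{u_0}$ and the $e_j$ with $u_0+\sum_{l=1}^{i-1}(u_l-u_0)<j\le u_0+\sum_{l=1}^{i}(u_l-u_0)$. Let $\widetilde G$ be a $k\times n$ matrix whose columns are, in some order, exactly one vector from each class $\{\lambda v:\lambda\in\mathbf F_q^*\}$ with $v\in\mathbf F_q^k\setminus(\{0\}\cup U_1\cup\cdots\cup U_h)$, and let $\mathbf C_3=\{a\widetilde G: a\in\mathbf F_q^k\}\subset\mathbf F_q^n$. A linear code $C\subset\mathbf F_q^n$ is an LRC with locality $r$ if for every position $i$ there is a set $A_i\subset\{1,\dots,n\}\setminus\{i\}$ with $|A_i|\le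 r$ such that, for all $a\ne a'$ in $\mathbf F_q$, no restriction to $A_i$ of a codeword $x\in C$ with $x_i=a$ equals the restriction to $A_i$ of a codeword $x'\in C$ with $x'_i=a'$. Let $k^{(q)}_{\mathrm{opt}}(m,d)$ be the maximum dimension of a linear code over $\mathbf F_q$ of length $m$ and minimum distance $d$ ($0$ if there is none). For a linear code $C$ of length $n$, dimension $\dim C$ and minimum distance $d$ with locality $r$, the CM defect is $$\min_{t\ge1,\ t(r+1)\le n}\bigl\{tr+k^{(q)}_{\mathrm{opt}}(n-t(r+1),d)\bigr\}-\dim C ;$$ $C$ meets the Cadambe–Mazumdar (CM) bound if its CM defect is $0$. It is an optimal LRC if no linear code with locality $r$ and the same length and minimum distance has larger dimension. Theorem. Let $u_0=1$. (a) If $h=2$, and $q\ge 3$ or ($q=2$ and $u_1<u_2$), then $\mathbf C_3$ is an LRC with locality $2$, it meets the CM bound, and it is an optimal LRC. (b) If $h=3$ and $q\ge4$, then $\mathbf C_3$ is an LRC with locality $2$, and its CM defect for $r=2$ is at most $1$. -/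

import Mathlib

/-!
Linear codes of length `n` over a finite field `F` are subspaces of `Fin n → F` with the Hamming
metric.
-/

/-- `d` is the minimum distance of the linear code `C`, that is the least distance between two
distinct codewords (the zero code has no minimum distance). -/
def HasMinDist {F : Type*} [Field F] [DecidableEq F] {n : ℕ}
    (C : Submodule F (Fin n → F)) (d : ℕ) : Prop :=
  IsLeast {e : ℕ | ∃ a ∈ C, ∃ b ∈ C, a ≠ b ∧ e = hammingDist a b} d

/-- `IsLinearCode C k d`: the code `C` is a linear `[n, k, d]` code. -/
def IsLinearCode {F : Type*} [Field F] [DecidableEq F] {n : ℕ}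
    (C : Submodule F (Fin n → F)) (k d : ℕ) : Prop :=
  Module.finrank F C = k ∧ HasMinDist C d

/-- The maximum dimension of a linear `[n, k, d]` code over `F`. If there is no such code, only the
zero code is left and the value is `0` (the supremum of the empty set of natural numbers). -/
noncomputable def kOpt (F : Type*) [Field F] [DecidableEq F] (n d : ℕ) : ℕ :=
  sSup {k : ℕ | ∃ C : Submodule F (Fin n → F), IsLinearCode C k d}

/-- The restriction to the positions in `A` of the codewords `x ∈ C` with `x i = a`. -/
def fiberRestriction {F : Type*} [Field F] {n : ℕ}
    (C : Submodule F (Fin n → F)) (A : Finset (Fin n)) (i : Fin n) (a : F) : Set (A → F) :=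
  (fun (x : Fin n → F) (j : A) => x j) '' {x : Fin n → F | x ∈ C ∧ x i = a}

/-- `C` is a locally recoverable code with locality `r`. -/
def IsLRC {F : Type*} [Field F] {n : ℕ} (C : Submodule F (Fin n → F)) (r : ℕ) : Prop :=
  ∀ i : Fin n, ∃ A : Finset (Fin n), i ∉ A ∧ A.card ≤ r ∧
    ∀ a a' : F, a ≠ a' → fiberRestriction C A i a ∩ fiberRestriction C A i a' = ∅

/-- The values `t r + k_opt(n - t (r + 1), d)`, where `t` runs over the positive integers for which
the length `n - t (r + 1)` is not negative. -/
def cmValues (F : Type*) [Field F] [DecidableEq F] (n d r : ℕ) : Set ℕ :=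
  {m : ℕ | ∃ t : ℕ, 1 ≤ t ∧ t * (r + 1) ≤ n ∧ m = t * r + kOpt F (n - t * (r + 1)) d}

/-- `δ` is the Cadambe-Mazumdar defect of `C` for the locality `r`: the minimum of the values
`t r + k_opt(n - t (r + 1), d)`, where `d` is the minimum distance of `C`, minus the dimension
of `C`. -/
def HasCMDefect {F : Type*} [Field F] [DecidableEq F] {n : ℕ}
    (C : Submodule F (Fin n → F)) (r : ℕ) (δ : ℤ) : Prop :=
  ∃ d m : ℕ, HasMinDist C d ∧ IsLeast (cmValues F n d r) m ∧ δ = (m : ℤ) - Module.finrank F C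

/-- `C` has locality `r`, and its dimension is the largest one among the linear codes with locality
`r` that have the same length and the same minimum distance. -/
def IsOptimalLRC {F : Type*} [Field F] [DecidableEq F] {n : ℕ}
    (C : Submodule F (Fin n → F)) (r : ℕ) : Prop :=
  IsLRC C r ∧ ∃ d : ℕ, HasMinDist C d ∧ ∀ C' : Submodule F (Fin n → F),
    IsLRC C' r → HasMinDist C' d → Module.finrank F C' ≤ Module.finrank F C

/-- The conditions on the parameters `q, k, h` and `u 0, u 1, ..., u h` of the construction. -/
structure AdmissibleParameters (q k h : ℕ) (u : ℕ → ℕ) : Prop where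
  three_le_k : 3 ≤ k
  two_le_h : 2 ≤ h
  h_le_q : h ≤ q
  one_le_u_zero : 1 ≤ u 0
  u_zero_lt : u 0 < u 1
  u_le_succ : ∀ i : ℕ, 1 ≤ i → i < h → u i ≤ u (i + 1)
  sum_le : (∑ i ∈ Finset.Icc 1 h, (u i : ℤ)) - ((h : ℤ) - 1) * u 0 ≤ k
  card_lt : (q : ℤ) ^ u 0 - 1 + ∑ i ∈ Finset.Icc 1 h, ((q : ℤ) ^ u i - (q : ℤ) ^ u 0)
    < (q : ℤ) ^ k - (q : ℤ) ^ (k - 1)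
  lt_u_one : ((h : ℚ) - 1) * (((q : ℚ) ^ u 0 - 1) / ((q : ℚ) - 1)) < u 1

/-- The subspace `U_i` of `F ^ k` spanned by the first `u 0` standard basis vectors and the `i`-th
one of the consecutive blocks of `u 1 - u 0, u 2 - u 0, ...` standard basis vectors that follow them
(the basis vectors are numbered from `0`). -/
def blockSubspace (F : Type*) [Field F] (k : ℕ) (u : ℕ → ℕ) (i : ℕ) : Submodule F (Fin k → F) :=
  Submodule.span F {v : Fin k → F | ∃ j : Fin k, v = Pi.single j 1 ∧
    ((j : ℕ) < u 0 ∨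
      (u 0 + ∑ l ∈ Finset.Icc 1 (i - 1), (u l - u 0) ≤ (j : ℕ) ∧
        (j : ℕ) < u 0 + ∑ l ∈ Finset.Icc 1 i, (u l - u 0)))}

/-- The nonzero vectors of `F ^ k` that lie in none of `U_1, ..., U_h`. -/
def remainingVectors (F : Type*) [Field F] (k h : ℕ) (u : ℕ → ℕ) : Set (Fin k → F) :=
  {v : Fin k → F | v ≠ 0 ∧ ∀ i : ℕ, 1 ≤ i → i ≤ h → v ∉ blockSubspace F k u i}

/-- The columns of `G` consist of exactly one vector from each class `{λ v | λ ≠ 0}`, `v ∈ S`,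
in some order. -/
def IsRepresentativeMatrix {F : Type*} [Field F] {k n : ℕ}
    (G : Matrix (Fin k) (Fin n) F) (S : Set (Fin k → F)) : Prop :=
  (∀ j : Fin n, G.col j ∈ S) ∧
    ∀ v ∈ S, ∃! j : Fin n, ∃ c : F, c ≠ 0 ∧ G.col j = c • v

/-- The linear code with generator matrix `G`, that is the set of all `a · G`. -/
def codeOf {F : Type*} [Field F] {k n : ℕ} (G : Matrix (Fin k) (Fin n) F) :
    Submodule F (Fin n → F) :=
  LinearMap.range G.vecMulLinear

/-! The weight of `x · G` is the number of columns off the hyperplane `x ⬝ᵥ v = 0`. All projective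
points together would give q^(k-1), and removing U_i costs at most q^(u_i-1). Every U_i costs
exactly that, without double counting, when x kills the common line but no U_i. Hence dim = k and d
= q^(k-1) - ∑ q^(u_i-1) (`IsSunflower.hasMinDist_and_finrank`).

If the subtracted powers produce no carries in base q, the Griesmer sum g of d can be bounded term
by term, and comparison with the length gives n ≤ g + h - 1 (`le_griesmerSum_add_sum`,
`IsSunflower.length_add_sum`). The last Griesmer term is 1, so dimension k - 1 needs length at least
g - 1. For t = 1, r = 2 the remaining length n - 3 ≤ g + h - 4 allows dimension at most k - 2 if h =
2 and k - 1 if h = 3. The CM minimum is thus at most k, respectively k + 1. For h = 2 the CM bound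
(`IsLRC.finrank_le_of_mem_cmValues`) forces equality, and it also bounds every competing code.

Locality 2 means that each column lies on a line with two other columns: a line through the common
point if q ≥ 3, a line found by counting if q = 2. -/

/-! ### Griesmer sums. -/

open Finset in
/-- The Griesmer sum `∑ ⌈d / q ^ j⌉` over `j < k`. -/
def griesmerSum (q k d : ℕ) : ℕ := ∑ j ∈ range k, d ⌈/⌉ q ^ j

theorem ceilDiv_ceilDiv_pow {q : ℕ} (hq : 0 < q) (d j : ℕ) :
    (d ⌈/⌉ q) ⌈/⌉ q ^ j = d ⌈/⌉ q ^ (j + 1) := by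
  refine eq_of_forall_ge_iff fun c => ?_
  rw [ceilDiv_le_iff_le_mul (pow_pos hq _), ceilDiv_le_iff_le_mul hq,
    ceilDiv_le_iff_le_mul (pow_pos hq _), pow_succ', mul_assoc]

/-- This recursion mirrors the passage to a residual code, which loses one dimension and keeps
distance at least ⌈d/q⌉. -/
theorem griesmerSum_succ {q : ℕ} (hq : 0 < q) (k d : ℕ) :
    griesmerSum q (k + 1) d = d + griesmerSum q k (d ⌈/⌉ q) := by
  unfold griesmerSum
  rw [Finset.sum_range_succ', add_comm]
  congr 1
  · simp
  · exact Finset.sum_congr rfl fun j _ => (ceilDiv_ceilDiv_pow hq d j).symm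

/-! ### Subcodes vanishing at given positions. -/

theorem finrank_le_finrank_inf_ker_add_one {F V : Type*} [Field F] [AddCommGroup V] [Module F V]
    [FiniteDimensional F V] (C : Submodule F V) (f : V →ₗ[F] F) :
    Module.finrank F C ≤ Module.finrank F ↥(C ⊓ LinearMap.ker f) + 1 := by
  have h := LinearMap.finrank_range_add_finrank_ker (f.domRestrict C)
  have h1 : Module.finrank F (LinearMap.range (f.domRestrict C)) ≤ 1 := by
    simpa using Submodule.finrank_le (LinearMap.range (f.domRestrict C))
  have h2 : Module.finrank F (LinearMap.ker (f.domRestrict C)) =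
      Module.finrank F ↥(C ⊓ LinearMap.ker f) := by
    rw [LinearMap.ker_domRestrict, ← Submodule.map_comap_subtype]
    exact (Submodule.finrank_map_subtype_eq C _).symm
  omega

/-- The codewords of `C` that vanish at the positions in `I`. -/
def vanishingOn {F ι : Type*} [Field F] (C : Submodule F (ι → F)) (I : Finset ι) :
    Submodule F (ι → F) where
  carrier := {x | x ∈ C ∧ ∀ i ∈ I, x i = 0}
  add_mem' := fun ha hb => ⟨C.add_mem ha.1 hb.1, fun i hi => by simp [ha.2 i hi, hb.2 i hi]⟩
  zero_mem' := ⟨C.zero_mem, fun _ _ => rfl⟩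
  smul_mem' := fun c _ ha => ⟨C.smul_mem c ha.1, fun i hi => by simp [ha.2 i hi]⟩

section Vanishing

variable {F ι : Type*} [Field F]

theorem mem_vanishingOn {C : Submodule F (ι → F)} {I : Finset ι} {x : ι → F} :
    x ∈ vanishingOn C I ↔ x ∈ C ∧ ∀ i ∈ I, x i = 0 := Iff.rfl

theorem vanishingOn_empty (C : Submodule F (ι → F)) : vanishingOn C ∅ = C := by
  ext x; simp [mem_vanishingOn]

theorem finrank_vanishingOn_le_insert [Finite ι] [DecidableEq ι] (C : Submodule F (ι → F))
    (I : Finset ι) (i : ι) :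
    Module.finrank F (vanishingOn C I) ≤ Module.finrank F (vanishingOn C (insert i I)) + 1 := by
  have h : vanishingOn C (insert i I) =
      vanishingOn C I ⊓ LinearMap.ker (LinearMap.proj i : (ι → F) →ₗ[F] F) := by
    ext x
    simp only [mem_vanishingOn, Finset.mem_insert, forall_eq_or_imp, Submodule.mem_inf,
      LinearMap.mem_ker, LinearMap.proj_apply]
    tauto
  rw [h]
  exact finrank_le_finrank_inf_ker_add_one _ _

/-- Each new position costs at most one dimension and adds one to the cardinality. -/
theorem finrank_vanishingOn_add_card_mono [Finite ι] [DecidableEq ι] (C : Submodule F (ι → F))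
    {I J : Finset ι} (h : I ⊆ J) :
    Module.finrank F (vanishingOn C I) + I.card ≤ Module.finrank F (vanishingOn C J) + J.card := by
  have key : ∀ B : Finset ι, Module.finrank F (vanishingOn C I) + I.card ≤
      Module.finrank F (vanishingOn C (B ∪ I)) + (B ∪ I).card := by
    intro B
    induction B using Finset.induction_on with
    | empty => rw [Finset.empty_union]
    | insert b B _ ih =>
      rw [Finset.insert_union]
      by_cases hb : b ∈ B ∪ I
      · rwa [Finset.insert_eq_of_mem hb]
      · have := finrank_vanishingOn_le_insert C (B ∪ I) b
        rw [Finset.card_insert_of_notMem hb]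
        omega
  have := key J
  rwa [Finset.union_eq_left.2 h] at this

end Vanishing

/-! ### The Griesmer bound. -/

section Griesmer

variable {F ι : Type*} [Field F] [Fintype F] [DecidableEq F]

/-- Count by positions: where c vanishes, x is unchanged for all q scalars; elsewhere exactly one
scalar, x i / c i, produces a zero. -/
theorem sum_card_sub_smul_ne_zero (S : Finset ι) (x c : ι → F) :
    ∑ l : F, (S.filter fun i => (x - l • c) i ≠ 0).card =
      Fintype.card F * ((S.filter fun i => c i = 0).filter fun i => x i ≠ 0).card +
        (Fintype.card F - 1) * (S.filter fun i => c i ≠ 0).card := by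
  have hterm : ∀ i, ∑ l : F, (if (x - l • c) i ≠ 0 then 1 else 0) =
      Fintype.card F * (if c i = 0 ∧ x i ≠ 0 then 1 else 0) +
        (Fintype.card F - 1) * (if c i ≠ 0 then 1 else 0) := by
    intro i
    rw [← Finset.card_filter]
    by_cases hc : c i = 0
    · by_cases hx : x i = 0 <;> simp [hc, hx]
    · have : (Finset.univ.filter fun l : F => (x - l • c) i ≠ 0) =
          Finset.univ.erase (x i / c i) := by
        ext l
        simp only [Finset.mem_filter, Finset.mem_univ, true_and, Finset.mem_erase, and_true,
          Pi.sub_apply, Pi.smul_apply, smul_eq_mul, ne_eq, sub_eq_zero, eq_div_iff hc]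
        tauto
      rw [this]
      simp [hc]
  simp_rw [Finset.filter_filter, Finset.card_filter]
  rw [Finset.sum_comm, Finset.sum_congr rfl fun i _ => hterm i, Finset.sum_add_distrib,
    Finset.mul_sum, Finset.mul_sum]

/-- The Griesmer bound, for the weight on a set `S` of positions. -/
theorem griesmerSum_le_card [Finite ι] (k : ℕ) : ∀ (S : Finset ι) (C : Submodule F (ι → F)) (d : ℕ),
    k ≤ Module.finrank F C → (∀ x ∈ C, x ≠ 0 → d ≤ (S.filter fun i => x i ≠ 0).card) →
      griesmerSum (Fintype.card F) k d ≤ S.card := by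
  classical
  induction k with
  | zero => intro S C d _ _; simp [griesmerSum]
  | succ k ih =>
    intro S C d hk hd
    have hex : ∃ w, ∃ c ∈ C, c ≠ 0 ∧ (S.filter fun i => c i ≠ 0).card = w := by
      have : C ≠ ⊥ := by
        rintro rfl
        simp at hk
      obtain ⟨c, hc, hc0⟩ := Submodule.exists_mem_ne_zero_of_ne_bot this
      exact ⟨_, c, hc, hc0, rfl⟩
    obtain ⟨c, hc, hc0, hw⟩ := Nat.find_spec hex
    have hmin : ∀ x ∈ C, x ≠ 0 →
        (S.filter fun i => c i ≠ 0).card ≤ (S.filter fun i => x i ≠ 0).card := by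
      intro x hx hx0
      rw [hw]
      exact Nat.find_min' hex ⟨x, hx, hx0, rfl⟩
    obtain ⟨i, hi⟩ := Function.ne_iff.1 hc0
    have hq : 1 < Fintype.card F := Fintype.one_lt_card
    have hd' := hd c hc hc0
    -- Residual code of a word c of least weight on S: keep the zeros of c in S. Requiring a zero at
    -- a position i with c i ≠ 0 removes the multiples of c and loses at most one dimension.
    have key := ih (S.filter fun i => c i = 0) (vanishingOn C {i}) (d ⌈/⌉ Fintype.card F)
      (by
        have := finrank_vanishingOn_le_insert C ∅ i
        rw [vanishingOn_empty] at this
        change _ ≤ Module.finrank F (vanishingOn C {i}) + 1 at this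
        omega)
      (by
        intro x hx hx0
        obtain ⟨hxC, hxi⟩ := mem_vanishingOn.1 hx
        rw [ceilDiv_le_iff_le_mul (by omega)]
        have hsum := sum_card_sub_smul_ne_zero S x c
        -- All q words x - l • c are nonzero, so each weighs at least as much as c; summing bounds
        -- the weight of x on the zeros of c.
        have hge : Fintype.card F * (S.filter fun i => c i ≠ 0).card ≤
            ∑ l : F, (S.filter fun i => (x - l • c) i ≠ 0).card := by
          rw [← smul_eq_mul, ← Finset.card_univ, ← Finset.sum_const]
          refine Finset.sum_le_sum fun l _ => hmin _ (C.sub_mem hxC (C.smul_mem l hc)) ?_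
          intro h0
          have h1 := congrFun h0 i
          simp only [Pi.sub_apply, Pi.smul_apply, hxi i (by simp), smul_eq_mul, zero_sub,
            Pi.zero_apply, neg_eq_zero, mul_eq_zero] at h1
          rcases h1 with h1 | h1
          · apply hx0
            simpa [h1] using h0
          · exact hi h1
        rw [hsum] at hge
        obtain ⟨p, hp⟩ := Nat.exists_eq_add_of_lt hq
        rw [hp] at hge ⊢
        simp only [Nat.add_sub_cancel] at hge
        nlinarith)
    have hsplit := Finset.card_filter_add_card_filter_not (s := S) (fun i => c i = 0)
    rw [griesmerSum_succ (by omega)]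
    simp only [ne_eq] at hd'
    omega

end Griesmer

/-! ### Minimum distance and `kOpt`. -/

section MinDist

variable {F : Type*} [Field F] [DecidableEq F]

theorem hammingDist_eq_hammingNorm_sub {ι : Type*} [Fintype ι] (a b : ι → F) :
    hammingDist a b = hammingNorm (a - b) := by
  simp [hammingDist, hammingNorm, sub_eq_zero]

theorem hasMinDist_iff {n d : ℕ} {C : Submodule F (Fin n → F)} :
    HasMinDist C d ↔ (∃ x ∈ C, x ≠ 0 ∧ hammingNorm x = d) ∧
      ∀ x ∈ C, x ≠ 0 → d ≤ hammingNorm x := by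
  constructor
  · rintro ⟨⟨a, ha, b, hb, hab, rfl⟩, hl⟩
    refine ⟨⟨a - b, C.sub_mem ha hb, sub_ne_zero.2 hab, (hammingDist_eq_hammingNorm_sub a b).symm⟩, ?_⟩
    intro x hx hx0
    exact hl ⟨x, hx, 0, C.zero_mem, hx0, (hammingDist_zero_right x).symm⟩
  · rintro ⟨⟨x, hx, hx0, rfl⟩, hl⟩
    refine ⟨⟨x, hx, 0, C.zero_mem, hx0, (hammingDist_zero_right x).symm⟩, ?_⟩
    rintro _ ⟨a, ha, b, hb, hab, rfl⟩
    rw [hammingDist_eq_hammingNorm_sub]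
    exact hl _ (C.sub_mem ha hb) (sub_ne_zero.2 hab)

theorem HasMinDist.griesmerSum_le [Fintype F] {n d k : ℕ} {C : Submodule F (Fin n → F)}
    (hC : HasMinDist C d) (hk : k ≤ Module.finrank F C) :
    griesmerSum (Fintype.card F) k d ≤ n := by
  simpa using griesmerSum_le_card k Finset.univ C d hk (hasMinDist_iff.1 hC).2

/-- A code can be modified so that its minimum distance drops to a prescribed positive value. -/
theorem exists_hasMinDist_of_le {n d : ℕ} (hd : 0 < d) :
    ∀ (e : ℕ) (C : Submodule F (Fin n → F)), HasMinDist C (d + e) →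
      ∃ C' : Submodule F (Fin n → F), Module.finrank F C' = Module.finrank F C ∧
        HasMinDist C' d := by
  intro e
  induction e with
  | zero => exact fun C hC => ⟨C, rfl, hC⟩
  | succ e ih =>
    intro C hC
    obtain ⟨⟨c, hc, hc0, hcd⟩, hmin⟩ := hasMinDist_iff.1 hC
    obtain ⟨i, hi⟩ := Function.ne_iff.1 hc0
    -- Zeroing a coordinate in the support of a minimum weight word c lowers the weight of c by one
    -- and no weight by more. As all nonzero weights are at least 2, no dimension is lost.
    let φ : (Fin n → F) →ₗ[F] (Fin n → F) :=
      LinearMap.pi fun j => if j = i then 0 else LinearMap.proj j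
    have hφ : ∀ x j, φ x j = if j = i then 0 else x j := by
      intro x j
      simp only [φ, LinearMap.pi_apply]
      split_ifs <;> simp
    have hnorm : ∀ x, hammingNorm x ≤ hammingNorm (φ x) + 1 := by
      intro x
      unfold hammingNorm
      refine (Finset.card_le_card (t := insert i (Finset.univ.filter fun j => φ x j ≠ 0)) ?_).trans
        (Finset.card_insert_le _ _)
      intro j hj
      by_cases hji : j = i
      · simp [hji]
      · simpa [hφ, hji] using hj
    have hnormc : hammingNorm (φ c) + 1 = hammingNorm c := by
      unfold hammingNorm
      rw [← Finset.card_insert_of_notMem (a := i) (by simp [hφ])]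
      congr 1
      ext j
      by_cases hji : j = i
      · subst hji; simpa using hi
      · simp [hφ, hji]
    have hne : ∀ x ∈ C, x ≠ 0 → φ x ≠ 0 := by
      intro x hx hx0 h0
      have h1 := hnorm x
      have h2 := hmin x hx hx0
      rw [h0, hammingNorm_zero] at h1
      omega
    have hinj : Function.Injective (φ.domRestrict C) := by
      rw [← LinearMap.ker_eq_bot, LinearMap.ker_eq_bot']
      intro x hx
      by_contra hx0
      exact hne x x.2 (by simpa using hx0) hx
    obtain ⟨C', hC', hd'⟩ := ih (C.map φ) (hasMinDist_iff.2 ⟨⟨φ c, Submodule.mem_map_of_mem hc,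
      hne c hc hc0, by omega⟩, by
        rintro _ ⟨x, hx, rfl⟩ hx0
        have h1 := hnorm x
        have h2 := hmin x hx (by rintro rfl; simp at hx0)
        omega⟩)
    refine ⟨C', hC'.trans ?_, hd'⟩
    rw [← LinearMap.finrank_range_of_inj hinj, LinearMap.range_domRestrict]

theorem le_kOpt_of_hasMinDist {n d : ℕ} {C : Submodule F (Fin n → F)} (hC : HasMinDist C d) :
    Module.finrank F C ≤ kOpt F n d := by
  refine le_csSup ⟨n, ?_⟩ ⟨C, rfl, hC⟩
  rintro _ ⟨C', rfl, _⟩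
  simpa using Submodule.finrank_le C'

theorem kOpt_le {n d m : ℕ}
    (h : ∀ C : Submodule F (Fin n → F), HasMinDist C d → Module.finrank F C ≤ m) :
    kOpt F n d ≤ m := by
  rcases Set.eq_empty_or_nonempty
    {k : ℕ | ∃ C : Submodule F (Fin n → F), IsLinearCode C k d} with h0 | h0
  · simp [kOpt, h0]
  · refine csSup_le h0 ?_
    rintro _ ⟨C, rfl, hC⟩
    exact h C hC

/-- `kOpt` asks for distance exactly d; a larger distance is first lowered to d by
`exists_hasMinDist_of_le`. -/
theorem le_kOpt_of_forall_le_hammingNorm {n d : ℕ} (hd : 0 < d) {C : Submodule F (Fin n → F)}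
    (hC : ∀ x ∈ C, x ≠ 0 → d ≤ hammingNorm x) : Module.finrank F C ≤ kOpt F n d := by
  classical
  by_cases hbot : C = ⊥
  · subst hbot; simp
  have hex : ∃ w, ∃ c ∈ C, c ≠ 0 ∧ hammingNorm c = w := by
    obtain ⟨c, hc, hc0⟩ := Submodule.exists_mem_ne_zero_of_ne_bot hbot
    exact ⟨_, c, hc, hc0, rfl⟩
  have hmd : HasMinDist C (Nat.find hex) := hasMinDist_iff.2
    ⟨Nat.find_spec hex, fun x hx hx0 => Nat.find_min' hex ⟨x, hx, hx0, rfl⟩⟩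
  obtain ⟨c, hc, hc0, hw⟩ := Nat.find_spec hex
  obtain ⟨e, he⟩ := Nat.exists_eq_add_of_le (hw ▸ hC c hc hc0)
  rw [he] at hmd
  obtain ⟨C', hC', hd'⟩ := exists_hasMinDist_of_le hd e C hmd
  exact hC' ▸ le_kOpt_of_hasMinDist hd'

end MinDist

/-! ### The Cadambe–Mazumdar bound. -/

section CadambeMazumdar

variable {F : Type*} [Field F] {n r : ℕ} {C : Submodule F (Fin n → F)}

theorem IsLRC.exists_recovery_set (hC : IsLRC C r) (i : Fin n) :
    ∃ A : Finset (Fin n), i ∉ A ∧ A.card ≤ r ∧ ∀ x ∈ C, (∀ j ∈ A, x j = 0) → x i = 0 := by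
  obtain ⟨A, hiA, hA, h⟩ := hC i
  refine ⟨A, hiA, hA, fun x hx hx0 => ?_⟩
  by_contra hne
  have hdis := h (x i) 0 hne
  apply (Set.eq_empty_iff_forall_notMem.1 hdis) (fun _ => 0)
  exact ⟨⟨x, ⟨hx, rfl⟩, funext fun j => hx0 j j.2⟩, ⟨0, ⟨C.zero_mem, rfl⟩, rfl⟩⟩

/-- Greedy choice: each round adds an unused position and its recovery set. Vanishing on the
recovery set forces a zero at that position, so it enlarges I at no cost in dimension; t rounds save
t dimensions. -/
theorem IsLRC.exists_card_le (hC : IsLRC C r) (t : ℕ) (ht : t * (r + 1) ≤ n) :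
    ∃ I : Finset (Fin n), I.card ≤ t * (r + 1) ∧
      Module.finrank F C + t ≤ Module.finrank F (vanishingOn C I) + I.card := by
  induction t with
  | zero => exact ⟨∅, by simp, by rw [vanishingOn_empty]; simp⟩
  | succ t ih =>
    rw [add_mul, one_mul] at ht
    obtain ⟨I, hI, hfr⟩ := ih (by omega)
    obtain ⟨i, hi⟩ : ∃ i, i ∉ I := by
      by_contra! h
      have : I = Finset.univ := Finset.eq_univ_iff_forall.2 h
      rw [this, Finset.card_univ, Fintype.card_fin] at hI
      omega
    obtain ⟨A, hiA, hA, hrec⟩ := hC.exists_recovery_set i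
    have hmono := finrank_vanishingOn_add_card_mono C (I := I) (J := I ∪ A)
      Finset.subset_union_left
    have heq : vanishingOn C (insert i (I ∪ A)) = vanishingOn C (I ∪ A) := by
      ext x
      simp only [mem_vanishingOn, Finset.mem_insert, forall_eq_or_imp]
      constructor
      · tauto
      · rintro ⟨hx, h0⟩
        exact ⟨hx, hrec x hx fun j hj => h0 j (Finset.mem_union_right _ hj), h0⟩
    refine ⟨insert i (I ∪ A), ?_, ?_⟩
    · have := Finset.card_union_le I A
      rw [Finset.card_insert_of_notMem (by simp [hi, hiA]), add_mul, one_mul]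
      omega
    · rw [heq, Finset.card_insert_of_notMem (by simp [hi, hiA])]
      omega

theorem IsLRC.exists_card_eq (hC : IsLRC C r) (t : ℕ) (ht : t * (r + 1) ≤ n) :
    ∃ I : Finset (Fin n), I.card = t * (r + 1) ∧
      Module.finrank F C ≤ t * r + Module.finrank F (vanishingOn C I) := by
  obtain ⟨I, hI, hfr⟩ := hC.exists_card_le t ht
  obtain ⟨J, hIJ, hJ⟩ := Finset.exists_superset_card_eq hI (by simpa using ht)
  have := finrank_vanishingOn_add_card_mono C hIJ
  refine ⟨J, hJ, ?_⟩
  rw [hJ, mul_add] at this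
  omega

/-- Deleting positions at which all codewords vanish. -/
theorem exists_code_of_vanishing [DecidableEq F] (D : Submodule F (Fin n → F)) (I : Finset (Fin n))
    (hD : ∀ x ∈ D, ∀ i ∈ I, x i = 0) (d : ℕ) (hd : ∀ x ∈ D, x ≠ 0 → d ≤ hammingNorm x) :
    ∃ D' : Submodule F (Fin (n - I.card) → F), Module.finrank F D' = Module.finrank F D ∧
      ∀ x ∈ D', x ≠ 0 → d ≤ hammingNorm x := by
  have hcard : Iᶜ.card = n - I.card := by rw [Finset.card_compl, Fintype.card_fin]
  let f : Fin (n - I.card) ↪o Fin n := Iᶜ.orderEmbOfFin hcard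
  have hf : ∀ j, j ∉ I → ∃ m, f m = j := by
    intro j hj
    have : j ∈ Set.range f := by
      rw [Finset.range_orderEmbOfFin]
      simpa using hj
    exact this
  let φ : (Fin n → F) →ₗ[F] (Fin (n - I.card) → F) := LinearMap.funLeft F F f
  have hφ : ∀ x m, φ x m = x (f m) := fun _ _ => rfl
  have hinj : Function.Injective (φ.domRestrict D) := by
    rw [← LinearMap.ker_eq_bot, LinearMap.ker_eq_bot']
    rintro ⟨x, hx⟩ h0
    rw [Submodule.mk_eq_zero]
    funext j
    by_cases hj : j ∈ I
    · exact hD x hx j hj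
    · obtain ⟨m, rfl⟩ := hf j hj
      exact congrFun h0 m
  refine ⟨D.map φ, ?_, ?_⟩
  · rw [← LinearMap.finrank_range_of_inj hinj, LinearMap.range_domRestrict]
  · rintro _ ⟨x, hx, rfl⟩ hx0
    refine (hd x hx (by rintro rfl; simp at hx0)).trans ?_
    unfold hammingNorm
    rw [← Finset.card_map f.toEmbedding]
    refine Finset.card_le_card fun j hj => ?_
    have hj0 : x j ≠ 0 := by simpa using hj
    obtain ⟨m, rfl⟩ := hf j fun hjI => hj0 (hD x hx j hjI)
    simpa [hφ] using hj0

/-- The Cadambe-Mazumdar bound. -/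
theorem IsLRC.finrank_le_of_mem_cmValues [DecidableEq F] {d m : ℕ} (hd : 0 < d) (hC : IsLRC C r)
    (hmin : HasMinDist C d) (hm : m ∈ cmValues F n d r) : Module.finrank F C ≤ m := by
  obtain ⟨t, _, ht, rfl⟩ := hm
  obtain ⟨I, hI, hfr⟩ := hC.exists_card_eq t ht
  obtain ⟨D, hD, hDd⟩ := exists_code_of_vanishing (vanishingOn C I) I (fun x hx => hx.2) d
    fun x hx hx0 => (hasMinDist_iff.1 hmin).2 x hx.1 hx0
  have := le_kOpt_of_forall_le_hammingNorm hd hDd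
  rw [← hI]
  omega

end CadambeMazumdar

/-! ### Griesmer sums without carries. -/

section Arithmetic

open Finset

theorem griesmerSum_sub_one {q k d : ℕ} (hk : 0 < k) (hd : 0 < d) (hdq : d ≤ q ^ (k - 1)) :
    griesmerSum q k d = griesmerSum q (k - 1) d + 1 := by
  obtain ⟨k, rfl⟩ := Nat.exists_eq_add_of_lt hk
  simp only [zero_add, Nat.add_sub_cancel] at hdq ⊢
  have hq : 0 < q ^ k := by omega
  rw [griesmerSum, sum_range_succ, ← griesmerSum]
  congr 1
  refine le_antisymm ((ceilDiv_le_iff_le_mul hq).2 (by simpa using hdq)) ?_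
  by_contra! h
  have := (ceilDiv_le_iff_le_mul hq (b := d) (c := 0)).1 (by omega)
  omega

/-- Divide `hd` by q^j: powers with exponent at least j divide exactly, and the others sum to less
than q^j, so they cannot contribute a full unit. -/
theorem le_ceilDiv_add_sum {I : Finset ℕ} {a : ℕ → ℕ} {q k d j : ℕ} (hq : 0 < q) (hj : j ≤ k)
    (hd : d + ∑ i ∈ I, q ^ a i = q ^ k) (hcarry : ∑ i ∈ I with a i < j, q ^ a i < q ^ j) :
    q ^ (k - j) ≤ d ⌈/⌉ q ^ j + ∑ i ∈ I with ¬ a i < j, q ^ (a i - j) := by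
  have hpos : 0 < q ^ j := pow_pos hq j
  have h1 : d ≤ q ^ j * (d ⌈/⌉ q ^ j) := (ceilDiv_le_iff_le_mul hpos).1 le_rfl
  have h2 : ∑ i ∈ I with ¬ a i < j, q ^ a i = q ^ j * ∑ i ∈ I with ¬ a i < j, q ^ (a i - j) := by
    rw [mul_sum]
    refine sum_congr rfl fun i hi => ?_
    have := (mem_filter.1 hi).2
    rw [← pow_add]
    congr 1
    omega
  have h3 : q ^ k = q ^ j * q ^ (k - j) := by rw [← pow_add]; congr 1; omega
  rw [← sum_filter_add_sum_filter_not I (fun i => a i < j), h2, h3] at hd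
  refine Nat.lt_succ_iff.1 (lt_of_mul_lt_mul_left (a := q ^ j) ?_ (Nat.zero_le _))
  rw [Nat.succ_eq_add_one, mul_add, mul_add]
  omega

/-- The Griesmer sum of a number `q ^ (k - 1) - ∑ q ^ a i` in which no carries occur. -/
theorem le_griesmerSum_add_sum {I : Finset ℕ} {a : ℕ → ℕ} {q k d : ℕ} (hq : 0 < q)
    (hd : d + ∑ i ∈ I, q ^ a i = q ^ (k - 1)) (ha : ∀ i ∈ I, a i < k)
    (hcarry : ∀ j, ∑ i ∈ I with a i < j, q ^ a i < q ^ j) :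
    ∑ j ∈ range k, q ^ j ≤
      griesmerSum q k d + ∑ i ∈ I, ∑ j ∈ range (a i + 1), q ^ j := by
  -- Regroup the geometric sums by the level j of the Griesmer term they correct.
  have h1 : ∑ i ∈ I, ∑ j ∈ range (a i + 1), q ^ j =
      ∑ j ∈ range k, ∑ i ∈ I with ¬ a i < j, q ^ (a i - j) := by
    simp_rw [sum_filter]
    rw [sum_comm]
    refine sum_congr rfl fun i hi => ?_
    rw [← sum_range_reflect, ← sum_filter]
    refine sum_congr ?_ fun j _ => by congr 1
    ext j
    have := ha i hi
    simp only [mem_range, mem_filter]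
    omega
  rw [h1, griesmerSum, ← sum_add_distrib, ← sum_range_reflect]
  refine sum_le_sum fun j hj => le_ceilDiv_add_sum hq ?_ hd (hcarry j)
  have := mem_range.1 hj
  omega

theorem sum_pow_lt_pow_of_card_lt {I : Finset ℕ} {a : ℕ → ℕ} {q : ℕ} (hI : I.card < q) (j : ℕ) :
    ∑ i ∈ I with a i < j, q ^ a i < q ^ j := by
  rcases Nat.eq_zero_or_pos j with rfl | hj
  · simp
  calc ∑ i ∈ I with a i < j, q ^ a i ≤ ∑ i ∈ I with a i < j, q ^ (j - 1) := by
        refine sum_le_sum fun i hi => Nat.pow_le_pow_right (by omega) ?_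
        have := (mem_filter.1 hi).2
        omega
    _ ≤ I.card * q ^ (j - 1) := by
        rw [sum_const, smul_eq_mul]
        exact Nat.mul_le_mul_right _ (card_filter_le _ _)
    _ < q * q ^ (j - 1) := Nat.mul_lt_mul_of_pos_right hI (pow_pos (by omega) _)
    _ = q ^ j := by rw [← pow_succ']; congr 1; omega

theorem sum_two_pow_lt_two_pow {I : Finset ℕ} {a : ℕ → ℕ} (ha : Set.InjOn a I) (j : ℕ) :
    ∑ i ∈ I with a i < j, 2 ^ a i < 2 ^ j := by
  rw [← sum_image (f := fun m => 2 ^ m) (g := a) (ha.mono fun i hi => (mem_filter.1 hi).1)]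
  refine (sum_le_sum_of_subset (t := range j) ?_).trans_lt ?_
  · intro m hm
    obtain ⟨i, hi, rfl⟩ := mem_image.1 hm
    exact mem_range.2 (mem_filter.1 hi).2
  · rw [Nat.geomSum_eq le_rfl]
    have : 0 < 2 ^ j := by positivity
    simp

end Arithmetic

/-! ### Counting vectors and columns. -/

section Counting

open Finset
open scoped Classical in
theorem card_filter_mem_and_apply_ne_zero {F V : Type*} [Field F] [Fintype F] [AddCommGroup V]
    [Module F V] [Fintype V] (U : Submodule F V) (f : V →ₗ[F] F) {a : ℕ}
    (hU : Nat.card U = Fintype.card F ^ (a + 1)) (hf : ∃ v ∈ U, f v ≠ 0) :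
    (univ.filter fun v => v ∈ U ∧ f v ≠ 0).card = (Fintype.card F - 1) * Fintype.card F ^ a := by
  obtain ⟨v, hv, hfv⟩ := hf
  have hq : 1 < Fintype.card F := Fintype.one_lt_card
  have hg : f.domRestrict U ≠ 0 := fun h => hfv (by simpa using LinearMap.congr_fun h ⟨v, hv⟩)
  have h1 := Module.Dual.finrank_ker_add_one_of_ne_zero hg
  have h2 : Module.finrank F U = a + 1 := by
    rw [Nat.card_eq_fintype_card, Module.card_eq_pow_finrank (K := F)] at hU
    exact Nat.pow_right_injective hq hU
  have h3 : (univ.filter fun v => v ∈ U ∧ f v = 0).card = Fintype.card F ^ a := by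
    have h4 : Nat.card (LinearMap.ker (f.domRestrict U)) = Fintype.card F ^ a := by
      rw [Nat.card_eq_fintype_card, Module.card_eq_pow_finrank (K := F)]
      congr 1
      omega
    rw [← h4, ← Fintype.card_subtype, ← Nat.card_eq_fintype_card]
    refine Nat.card_congr
      ⟨fun x => ⟨⟨x, x.2.1⟩, x.2.2⟩, fun x => ⟨x.1, x.1.2, x.2⟩, fun _ => rfl, fun _ => rfl⟩
  have h5 := card_filter_add_card_filter_not (s := univ.filter fun v => v ∈ U) (fun v => f v = 0)
  rw [filter_filter, filter_filter, h3, ← Fintype.card_subtype (fun v => v ∈ U)] at h5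
  have h6 : Fintype.card {v // v ∈ U} = Fintype.card F ^ (a + 1) := by
    rw [← hU, Nat.card_eq_fintype_card]
  rw [h6, pow_succ'] at h5
  rw [Nat.sub_mul, one_mul]
  exact Nat.eq_sub_of_add_eq' h5

open scoped Classical in
theorem card_filter_mem_and_dotProduct_ne_zero {F : Type*} [Field F] [Fintype F] [DecidableEq F]
    {k : ℕ}
    (U : Submodule F (Fin k → F)) (x : Fin k → F) {a : ℕ}
    (hU : Nat.card U = Fintype.card F ^ (a + 1)) (hx : ∃ v ∈ U, x ⬝ᵥ v ≠ 0) :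
    (univ.filter fun v => v ∈ U ∧ x ⬝ᵥ v ≠ 0).card =
      (Fintype.card F - 1) * Fintype.card F ^ a := by
  convert card_filter_mem_and_apply_ne_zero U (dotProductBilin F F x) hU hx
  rfl

/-- Every vector of S is a unique nonzero multiple of a unique column, so (unit, column) ↦ product
is a bijection. -/
theorem IsRepresentativeMatrix.card_filter {F : Type*} [Field F] [Fintype F] {k n : ℕ}
    {G : Matrix (Fin k) (Fin n) F} {S : Set (Fin k → F)} (hG : IsRepresentativeMatrix G S)
    (hS : ∀ v ∈ S, ∀ c : F, c ≠ 0 → c • v ∈ S) (hS0 : (0 : Fin k → F) ∉ S)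
    (P : (Fin k → F) → Prop) (hP : ∀ v, ∀ c : F, c ≠ 0 → (P (c • v) ↔ P v)) :
    (Fintype.card F - 1) * Nat.card {j // P (G.col j)} = Nat.card {v // v ∈ S ∧ P v} := by
  classical
  rw [← Fintype.card_units, ← Nat.card_eq_fintype_card, ← Nat.card_prod]
  refine Nat.card_congr (Equiv.ofBijective (fun x => ⟨(x.1 : F) • G.col x.2,
    hS _ (hG.1 _) _ x.1.ne_zero, (hP _ _ x.1.ne_zero).2 x.2.2⟩) ⟨?_, ?_⟩)
  · rintro ⟨c, j, hj⟩ ⟨c', j', hj'⟩ h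
    have h : (c : F) • G.col j = (c' : F) • G.col j' := congrArg Subtype.val h
    have hjj : j = j' := by
      refine (hG.2 _ (hS _ (hG.1 j) c c.ne_zero)).unique ⟨(c : F)⁻¹, by simp, ?_⟩
        ⟨(c' : F)⁻¹, by simp, ?_⟩
      · rw [inv_smul_smul₀ c.ne_zero]
      · rw [h, inv_smul_smul₀ c'.ne_zero]
    subst hjj
    have hne : G.col j ≠ 0 := fun h0 => hS0 (h0 ▸ hG.1 j)
    have : c = c' := Units.ext (smul_left_injective F hne h)
    rw [this]
  · rintro ⟨v, hv, hPv⟩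
    obtain ⟨j, ⟨c, hc, hjc⟩, -⟩ := hG.2 v hv
    refine ⟨⟨(Units.mk0 c hc)⁻¹, j, hjc ▸ (hP v c hc).2 hPv⟩, Subtype.ext ?_⟩
    simp [hjc, inv_smul_smul₀ hc]

end Counting

/-! ### Length and weights for the complement of a sunflower. -/

open Finset in
/-- Subspaces `U i`, `i ∈ I`, of `F ^ k` with `q ^ (a i + 1)` elements, any two of which meet in the
line `L`. -/
structure IsSunflower {F : Type*} [Field F] [Fintype F] {k : ℕ} (I : Finset ℕ)
    (U : ℕ → Submodule F (Fin k → F)) (L : Submodule F (Fin k → F)) (a : ℕ → ℕ) : Prop where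
  nonempty : I.Nonempty
  card_core : Nat.card L = Fintype.card F
  core_le : ∀ i ∈ I, L ≤ U i
  inf_le : ∀ i ∈ I, ∀ j ∈ I, i ≠ j → U i ⊓ U j ≤ L
  card_petal : ∀ i ∈ I, Nat.card (U i) = Fintype.card F ^ (a i + 1)

namespace IsSunflower

open Finset

variable {F : Type*} [Field F] [Fintype F] {k : ℕ} {I : Finset ℕ}
  {U : ℕ → Submodule F (Fin k → F)} {L : Submodule F (Fin k → F)} {a : ℕ → ℕ}

open scoped Classical in
-- The sets U i \ L are disjoint and the core L counts once; the additive form avoids natural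
-- subtraction.
theorem card_union (hs : IsSunflower I U L a) :
    (univ.filter fun v : Fin k → F => ∃ i ∈ I, v ∈ U i).card + I.card * Fintype.card F =
      Fintype.card F + ∑ i ∈ I, Fintype.card F ^ (a i + 1) := by
  have hL : (univ.filter fun v : Fin k → F => v ∈ L).card = Fintype.card F := by
    rw [← hs.card_core, Nat.card_eq_fintype_card, Fintype.card_subtype]
  have hW : (univ.filter fun v : Fin k → F => ∃ i ∈ I, v ∈ U i) =
      (univ.filter fun v : Fin k → F => v ∈ L) ∪
        I.biUnion fun i => univ.filter fun v : Fin k → F => v ∈ U i ∧ v ∉ L := by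
    ext v
    simp only [mem_filter, mem_univ, true_and, mem_union, mem_biUnion]
    constructor
    · rintro ⟨i, hi, hv⟩
      by_cases hvL : v ∈ L
      · exact Or.inl hvL
      · exact Or.inr ⟨i, hi, hv, hvL⟩
    · rintro (hv | ⟨i, hi, hv, -⟩)
      · obtain ⟨i, hi⟩ := hs.nonempty
        exact ⟨i, hi, hs.core_le i hi hv⟩
      · exact ⟨i, hi, hv⟩
  have hpetal : ∀ i ∈ I, (univ.filter fun v : Fin k → F => v ∈ U i ∧ v ∉ L).card +
      Fintype.card F = Fintype.card F ^ (a i + 1) := by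
    intro i hi
    have h := card_filter_add_card_filter_not (s := univ.filter fun v : Fin k → F => v ∈ U i)
      (fun v => v ∈ L)
    rw [filter_filter, filter_filter, ← Fintype.card_subtype (fun v => v ∈ U i),
      ← Nat.card_eq_fintype_card] at h
    have h' : Nat.card {v // v ∈ U i} = Fintype.card F ^ (a i + 1) := hs.card_petal i hi
    rw [← h', ← h, add_comm]
    congr 1
    rw [← hL]
    congr 1
    ext v
    simpa using fun hv => hs.core_le i hi hv
  rw [hW, card_union_of_disjoint, card_biUnion, hL, add_assoc, ← smul_eq_mul, ← sum_const,
    ← sum_add_distrib, sum_congr rfl hpetal]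
  · intro i hi j hj hij
    refine disjoint_left.2 ?_
    intro v hv hv'
    simp only [mem_filter, mem_univ, true_and] at hv hv'
    exact hv.2 (hs.inf_le i hi j hj hij ⟨hv.1, hv'.1⟩)
  · rw [disjoint_left]
    intro v hv hv'
    simp only [mem_filter, mem_univ, true_and, mem_biUnion] at hv hv'
    obtain ⟨i, -, -, h⟩ := hv'
    exact h hv

section Matrix

variable {n : ℕ} {G : Matrix (Fin k) (Fin n) F}
  (hG : IsRepresentativeMatrix G {v | v ≠ 0 ∧ ∀ i ∈ I, v ∉ U i})
include hG

open scoped Classical in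
theorem card_filter_col (hs : IsSunflower I U L a)
    (P : (Fin k → F) → Prop) (hP : ∀ v, ∀ c : F, c ≠ 0 → (P (c • v) ↔ P v)) :
    (Fintype.card F - 1) * (univ.filter fun j => P (G.col j)).card +
      (univ.filter fun v : Fin k → F => (∃ i ∈ I, v ∈ U i) ∧ P v).card =
        (univ.filter P).card := by
  have h := hG.card_filter (fun v hv c hc => ⟨smul_ne_zero hc hv.1, fun i hi hcv =>
    hv.2 i hi ((Submodule.smul_mem_iff _ hc).1 hcv)⟩) (fun h => h.1 rfl) P hP
  rw [Nat.card_eq_fintype_card, Nat.card_eq_fintype_card, Fintype.card_subtype,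
    Fintype.card_subtype] at h
  rw [h, add_comm, ← card_filter_add_card_filter_not (s := univ.filter P)
    (fun v => ∃ i ∈ I, v ∈ U i), filter_filter, filter_filter]
  congr 2
  · ext v
    simp only [mem_filter, mem_univ, true_and]
    tauto
  · ext v
    simp only [mem_filter, mem_univ, true_and, Set.mem_ofPred_eq]
    constructor
    · rintro ⟨⟨_, h⟩, hPv⟩
      exact ⟨hPv, fun ⟨i, hi, hv⟩ => h i hi hv⟩
    · rintro ⟨hPv, h⟩
      refine ⟨⟨?_, fun i hi hv => h ⟨i, hi, hv⟩⟩, hPv⟩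
      rintro rfl
      obtain ⟨i, hi⟩ := hs.nonempty
      exact h ⟨i, hi, (U i).zero_mem⟩

open scoped Classical in
theorem length_mul (hs : IsSunflower I U L a) :
    (Fintype.card F - 1) * n + (univ.filter fun v : Fin k → F => ∃ i ∈ I, v ∈ U i).card =
      Fintype.card F ^ k := by
  simpa using hs.card_filter_col hG (fun _ => True) (by simp)

theorem length_add_sum (hs : IsSunflower I U L a) :
    n + ∑ i ∈ I, ∑ j ∈ range (a i + 1), Fintype.card F ^ j + 1 =
      ∑ j ∈ range k, Fintype.card F ^ j + I.card := by
  classical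
  have h1 := hs.length_mul hG
  have h2 := hs.card_union
  obtain ⟨p, hp⟩ := Nat.exists_eq_add_of_lt (Fintype.one_lt_card (α := F))
  have hgeom : ∀ m, (p + 1) * ∑ j ∈ range m, Fintype.card F ^ j + 1 = Fintype.card F ^ m := by
    intro m
    rw [show Fintype.card F = p + 1 + 1 by omega, ← geom_sum_mul_add (p + 1) m, mul_comm]
  have h3 : (p + 1) * ∑ i ∈ I, ∑ j ∈ range (a i + 1), Fintype.card F ^ j + I.card =
      ∑ i ∈ I, Fintype.card F ^ (a i + 1) := by
    rw [mul_sum, card_eq_sum_ones, ← sum_add_distrib]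
    exact sum_congr rfl fun i _ => hgeom _
  have h4 := hgeom k
  have hp1 : Fintype.card F - 1 = p + 1 := by omega
  have hp2 : Fintype.card F = p + 2 := by omega
  rw [hp1] at h1
  rw [← h3] at h2
  rw [← h4] at h1
  refine Nat.eq_of_mul_eq_mul_left (Nat.succ_pos p) ?_
  rw [Nat.succ_eq_add_one]
  generalize ∑ i ∈ I, ∑ j ∈ range (a i + 1), Fintype.card F ^ j = x at *
  generalize ∑ j ∈ range k, Fintype.card F ^ j = y at *
  rw [hp2] at h2
  zify at *
  linear_combination h1 - h2

variable [DecidableEq F]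

open scoped Classical in
theorem mul_hammingNorm_add_card (hs : IsSunflower I U L a) {x : Fin k → F} (hx : x ≠ 0) :
    (Fintype.card F - 1) * hammingNorm (Matrix.vecMul x G) +
      (univ.filter fun v : Fin k → F => (∃ i ∈ I, v ∈ U i) ∧ x ⬝ᵥ v ≠ 0).card =
        (Fintype.card F - 1) * Fintype.card F ^ (k - 1) := by
  obtain ⟨j, hj⟩ := Function.ne_iff.1 hx
  have hk : k - 1 + 1 = k := by have := j.2; omega
  have h := hs.card_filter_col hG (fun v => x ⬝ᵥ v ≠ 0) (by
    intro v c hc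
    simp [hc])
  have h2 := card_filter_mem_and_dotProduct_ne_zero (⊤ : Submodule F (Fin k → F)) x (a := k - 1) (by simp [hk])
    ⟨Pi.single j 1, trivial, by simpa using hj⟩
  rw [← h2]
  have h3 : (univ.filter fun v => v ∈ (⊤ : Submodule F (Fin k → F)) ∧ x ⬝ᵥ v ≠ 0) =
      univ.filter fun v => x ⬝ᵥ v ≠ 0 := by
    ext v
    simp
  rw [h3]
  convert h
  unfold hammingNorm
  congr

/-- Union bound: a petal has (q - 1) q^(a i) vectors off the hyperplane of x, or none. -/
theorem le_hammingNorm_add_sum (hs : IsSunflower I U L a) {x : Fin k → F} (hx : x ≠ 0) :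
    Fintype.card F ^ (k - 1) ≤
      hammingNorm (Matrix.vecMul x G) + ∑ i ∈ I, Fintype.card F ^ a i := by
  classical
  have hq : 1 < Fintype.card F := Fintype.one_lt_card
  refine le_of_mul_le_mul_left (a := Fintype.card F - 1) ?_ (by omega)
  rw [← hs.mul_hammingNorm_add_card hG hx, mul_add]
  refine Nat.add_le_add_left ?_ _
  have : (univ.filter fun v : Fin k → F => (∃ i ∈ I, v ∈ U i) ∧ x ⬝ᵥ v ≠ 0) =
      I.biUnion fun i => univ.filter fun v : Fin k → F => v ∈ U i ∧ x ⬝ᵥ v ≠ 0 := by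
    ext v
    simp only [mem_filter, mem_univ, true_and, mem_biUnion]
    tauto
  rw [this, mul_sum]
  refine card_biUnion_le.trans (sum_le_sum fun i hi => ?_)
  by_cases hf : ∃ v ∈ U i, x ⬝ᵥ v ≠ 0
  · exact (card_filter_mem_and_dotProduct_ne_zero (U i) x (hs.card_petal i hi)
      hf).le
  · rw [filter_false_of_mem]
    · simp
    · exact fun v _ hv => hf ⟨v, hv⟩

/-- The union bound is sharp here: petals overlap only in L, where x vanishes, and none lies in the
hyperplane. -/
theorem hammingNorm_add_sum_eq (hs : IsSunflower I U L a) {x : Fin k → F}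
    (hL : ∀ v ∈ L, x ⬝ᵥ v = 0) (hU : ∀ i ∈ I, ∃ v ∈ U i, x ⬝ᵥ v ≠ 0) :
    hammingNorm (Matrix.vecMul x G) + ∑ i ∈ I, Fintype.card F ^ a i =
      Fintype.card F ^ (k - 1) := by
  classical
  have hx : x ≠ 0 := by
    rintro rfl
    obtain ⟨i, hi⟩ := hs.nonempty
    obtain ⟨v, -, hv⟩ := hU i hi
    simp at hv
  have hq : 1 < Fintype.card F := Fintype.one_lt_card
  refine Nat.eq_of_mul_eq_mul_left (Nat.sub_pos_of_lt hq) ?_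
  rw [← hs.mul_hammingNorm_add_card hG hx, mul_add]
  congr 1
  have : (univ.filter fun v : Fin k → F => (∃ i ∈ I, v ∈ U i) ∧ x ⬝ᵥ v ≠ 0) =
      I.biUnion fun i => univ.filter fun v : Fin k → F => v ∈ U i ∧ x ⬝ᵥ v ≠ 0 := by
    ext v
    simp only [mem_filter, mem_univ, true_and, mem_biUnion]
    tauto
  rw [this, mul_sum, card_biUnion]
  · exact sum_congr rfl fun i hi => (card_filter_mem_and_dotProduct_ne_zero (U i) x
      (hs.card_petal i hi) (hU i hi)).symm
  · intro i hi j hj hij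
    refine disjoint_left.2 ?_
    intro v hv hv'
    simp only [mem_filter, mem_univ, true_and] at hv hv'
    exact hv.2 (hL v (hs.inf_le i hi j hj hij ⟨hv.1, hv'.1⟩))

end Matrix

end IsSunflower

/-! ### Locality 2. -/

section Locality

open Finset

variable {F : Type*} [Field F] {k n : ℕ} {G : Matrix (Fin k) (Fin n) F}

theorem isLRC_two_of_col_eq (h : ∀ j, ∃ j₁ j₂, j₁ ≠ j ∧ j₂ ≠ j ∧ ∃ α β : F,
    G.col j = α • G.col j₁ + β • G.col j₂) : IsLRC (codeOf G) 2 := by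
  intro j
  obtain ⟨j₁, j₂, h₁, h₂, α, β, hj⟩ := h j
  refine ⟨{j₁, j₂}, by simp [h₁.symm, h₂.symm], card_le_two, fun b b' hb => ?_⟩
  rw [Set.eq_empty_iff_forall_notMem]
  rintro _ ⟨⟨y, ⟨hy, hyb⟩, rfl⟩, ⟨y', ⟨hy', hyb'⟩, hyy⟩⟩
  have hrec : ∀ y ∈ codeOf G, y j = α * y j₁ + β * y j₂ := by
    rintro _ ⟨x, rfl⟩
    change x ⬝ᵥ G.col j = α * (x ⬝ᵥ G.col j₁) + β * (x ⬝ᵥ G.col j₂)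
    rw [hj, dotProduct_add, dotProduct_smul, dotProduct_smul, smul_eq_mul, smul_eq_mul]
  have e₁ : y' j₁ = y j₁ := congrFun hyy ⟨j₁, by simp⟩
  have e₂ : y' j₂ = y j₂ := congrFun hyy ⟨j₂, by simp⟩
  apply hb
  rw [← hyb, ← hyb', hrec y hy, hrec y' hy', e₁, e₂]

theorem IsRepresentativeMatrix.isLRC_two {S : Set (Fin k → F)} (hG : IsRepresentativeMatrix G S)
    (h : ∀ v ∈ S, ∃ w₁ ∈ S, ∃ w₂ ∈ S, (∀ c : F, w₁ ≠ c • v) ∧ (∀ c : F, w₂ ≠ c • v) ∧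
      ∃ α β : F, v = α • w₁ + β • w₂) : IsLRC (codeOf G) 2 := by
  refine isLRC_two_of_col_eq fun j => ?_
  obtain ⟨w₁, hw₁, w₂, hw₂, hc₁, hc₂, α, β, hv⟩ := h _ (hG.1 j)
  obtain ⟨j₁, ⟨c₁, hne₁, hj₁⟩, -⟩ := hG.2 _ hw₁
  obtain ⟨j₂, ⟨c₂, hne₂, hj₂⟩, -⟩ := hG.2 _ hw₂
  refine ⟨j₁, j₂, ?_, ?_, α * c₁⁻¹, β * c₂⁻¹, ?_⟩
  · rintro rfl
    exact hc₁ c₁⁻¹ (by rw [hj₁, inv_smul_smul₀ hne₁])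
  · rintro rfl
    exact hc₂ c₂⁻¹ (by rw [hj₂, inv_smul_smul₀ hne₂])
  · rw [hj₁, hj₂, mul_smul, mul_smul, inv_smul_smul₀ hne₁, inv_smul_smul₀ hne₂]
    exact hv

variable [Fintype F] {I : Finset ℕ} {U : ℕ → Submodule F (Fin k → F)}
  {L : Submodule F (Fin k → F)} {a : ℕ → ℕ}

/-- The line through a remaining point and the common point of the petals has `q` remaining
points. -/
theorem IsSunflower.isLRC_two_of_three_le_card
    (hG : IsRepresentativeMatrix G {v | v ≠ 0 ∧ ∀ i ∈ I, v ∉ U i}) (hs : IsSunflower I U L a)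
    (hq : 3 ≤ Fintype.card F) : IsLRC (codeOf G) 2 := by
  classical
  have hLbot : L ≠ ⊥ := by
    rintro rfl
    have := hs.card_core
    rw [Nat.card_unique] at this
    omega
  obtain ⟨e, he, he0⟩ := Submodule.exists_mem_ne_zero_of_ne_bot hLbot
  obtain ⟨i₀, hi₀⟩ := hs.nonempty
  obtain ⟨l, hl⟩ : ∃ l : F, l ∉ ({0, 1} : Finset F) := by
    by_contra! h
    have h2 : (univ : Finset F).card ≤ ({0, 1} : Finset F).card := card_le_card fun x _ => h x
    have h3 := card_le_two (a := (0 : F)) (b := 1)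
    rw [card_univ] at h2
    omega
  simp only [mem_insert, mem_singleton, not_or] at hl
  have hS : ∀ v : Fin k → F, (v ≠ 0 ∧ ∀ i ∈ I, v ∉ U i) → ∀ c : F,
      v + c • e ≠ 0 ∧ ∀ i ∈ I, v + c • e ∉ U i := by
    intro v hv c
    have hU : ∀ i ∈ I, v + c • e ∉ U i := fun i hi h => hv.2 i hi
      (((U i).add_mem_iff_left ((U i).smul_mem c (hs.core_le i hi he))).1 h)
    exact ⟨fun h => hU i₀ hi₀ (h ▸ (U i₀).zero_mem), hU⟩
  have hne : ∀ v : Fin k → F, (v ≠ 0 ∧ ∀ i ∈ I, v ∉ U i) → ∀ c : F, c ≠ 0 →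
      ∀ b : F, v + c • e ≠ b • v := by
    intro v hv c hc b h
    have h' : c • e = (b - 1) • v := by
      rw [sub_smul, one_smul, ← h, add_sub_cancel_left]
    by_cases hb : b - 1 = 0
    · rw [hb, zero_smul] at h'
      exact (smul_ne_zero hc he0) h'
    · exact hv.2 i₀ hi₀ (((U i₀).smul_mem_iff hb).1
        (h' ▸ (U i₀).smul_mem c (hs.core_le i₀ hi₀ he)))
  -- The coefficients solve α + β = 1 and α + β l = 0, which needs l ≠ 1.
  refine hG.isLRC_two fun v hv => ⟨v + (1 : F) • e, hS v hv 1, v + l • e, hS v hv l,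
    hne v hv 1 one_ne_zero, hne v hv l hl.1, (l - 1)⁻¹ * l, -(l - 1)⁻¹, ?_⟩
  have hl1 : l - 1 ≠ 0 := sub_ne_zero.2 hl.2
  funext j
  simp only [Pi.add_apply, Pi.smul_apply, smul_eq_mul]
  field_simp
  ring

open scoped Classical in
-- Over two elements a line through the core point has only two other points. Instead, by `hW`, the
-- union W of the petals and its reflection v - W cannot cover the space; any w outside both gives
-- the line v, w, v - w.
theorem IsSunflower.isLRC_two_of_card_eq_two
    (hG : IsRepresentativeMatrix G {v | v ≠ 0 ∧ ∀ i ∈ I, v ∉ U i}) (hs : IsSunflower I U L a)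
    (hq : Fintype.card F = 2)
    (hW : 2 * (univ.filter fun v : Fin k → F => ∃ i ∈ I, v ∈ U i).card < 2 ^ k) :
    IsLRC (codeOf G) 2 := by
  obtain ⟨i₀, hi₀⟩ := hs.nonempty
  have hF : ∀ c : F, c = 0 ∨ c = 1 := by
    intro c
    have : ({0, 1} : Finset F) = univ := eq_univ_of_card _ (by rw [hq, card_pair zero_ne_one])
    have hc : c ∈ ({0, 1} : Finset F) := this ▸ mem_univ c
    simpa using hc
  have hS0 : ∀ v : Fin k → F, (¬ ∃ i ∈ I, v ∈ U i) → v ≠ 0 ∧ ∀ i ∈ I, v ∉ U i := by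
    intro v hv
    refine ⟨?_, fun i hi h => hv ⟨i, hi, h⟩⟩
    rintro rfl
    exact hv ⟨i₀, hi₀, (U i₀).zero_mem⟩
  refine hG.isLRC_two fun v hv => ?_
  obtain ⟨w, hw⟩ : ∃ w : Fin k → F, (¬ ∃ i ∈ I, w ∈ U i) ∧ ¬ ∃ i ∈ I, v - w ∈ U i := by
    by_contra! h
    have hcover : (univ : Finset (Fin k → F)) ⊆
        (univ.filter fun v : Fin k → F => ∃ i ∈ I, v ∈ U i) ∪
          (univ.filter fun v : Fin k → F => ∃ i ∈ I, v ∈ U i).image fun w => v - w := by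
      intro w _
      by_cases hw : ∃ i ∈ I, w ∈ U i
      · exact mem_union_left _ (by simpa using hw)
      · refine mem_union_right _ (mem_image.2 ⟨v - w, ?_, by abel⟩)
        have := h w (by simpa using hw)
        simpa using this
    have h1 := (card_le_card hcover).trans (card_union_le _ _)
    have h2 := card_image_le (f := fun w => v - w)
      (s := univ.filter fun v : Fin k → F => ∃ i ∈ I, v ∈ U i)
    rw [card_univ, Fintype.card_fun, hq, Fintype.card_fin] at h1
    omega
  have hw₁ := hS0 _ hw.1
  have hw₂ := hS0 _ hw.2
  refine ⟨w, hw₁, v - w, hw₂, ?_, ?_, 1, 1, by simp⟩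
  · rintro c h
    rcases hF c with rfl | rfl
    · exact hw₁.1 (by simpa using h)
    · exact hw₂.1 (by simp [h])
  · rintro c h
    rcases hF c with rfl | rfl
    · exact hw₂.1 (by simpa using h)
    · exact hw₁.1 (by simpa using h)

end Locality

/-! ### The CM value at t = 1. -/

section Defect

open Finset

theorem le_griesmerSum {q k d : ℕ} (hq : 0 < q) (hd : 0 < d) : k ≤ griesmerSum q k d := by
  have : ∑ j ∈ range k, 1 ≤ griesmerSum q k d := by
    refine sum_le_sum fun j _ => ?_
    by_contra! h
    have := (ceilDiv_le_iff_le_mul (pow_pos hq j) (b := d) (c := 0)).1 (by omega)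
    omega
  simpa using this

/-- The bounds on `t r + k_opt(n - t (r + 1), d)` for `t = 1`, `r = 2` given by the Griesmer bound
for a code whose length exceeds that bound by less than `s`. -/
theorem kOpt_sub_three_le {F : Type*} [Field F] [Fintype F] [DecidableEq F] {n k d s : ℕ}
    (hk : 2 ≤ k) (hn : 3 ≤ n) (hs : s ≤ 3) (hd : 0 < d) (hdq : d ≤ Fintype.card F ^ (k - 1))
    (h : n + 1 ≤ griesmerSum (Fintype.card F) k d + s) :
    kOpt F (n - 3) d + 4 ≤ k + max s 2 := by
  have h1 := griesmerSum_sub_one (by omega) hd hdq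
  have : kOpt F (n - 3) d ≤ k + max s 2 - 4 := by
    refine kOpt_le fun C hC => ?_
    by_contra! hlt
    -- Dimension at least k would need s ≥ 4, and dimension k - 1 would need s ≥ 3; hence the bound
    -- k - 2 for s ≤ 2 and k - 1 for s = 3.
    rcases le_or_gt k (Module.finrank F C) with hle | hgt
    · have := hC.griesmerSum_le hle
      omega
    · have := hC.griesmerSum_le (k := k - 1) (by omega)
      omega
  omega

variable {F : Type*} [Field F] [Fintype F] [DecidableEq F] {k n : ℕ} {I : Finset ℕ}
  {U : ℕ → Submodule F (Fin k → F)} {L : Submodule F (Fin k → F)} {a : ℕ → ℕ}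
  {G : Matrix (Fin k) (Fin n) F}

theorem IsSunflower.hasMinDist_and_finrank
    (hG : IsRepresentativeMatrix G {v | v ≠ 0 ∧ ∀ i ∈ I, v ∉ U i}) (hs : IsSunflower I U L a)
    {x : Fin k → F} (hL : ∀ v ∈ L, x ⬝ᵥ v = 0) (hU : ∀ i ∈ I, ∃ v ∈ U i, x ⬝ᵥ v ≠ 0) {d : ℕ}
    (hd0 : 0 < d) (hd : d + ∑ i ∈ I, Fintype.card F ^ a i = Fintype.card F ^ (k - 1)) :
    HasMinDist (codeOf G) d ∧ Module.finrank F (codeOf G) = k := by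
  have hge : ∀ y : Fin k → F, y ≠ 0 → d ≤ hammingNorm (Matrix.vecMul y G) := by
    intro y hy
    have := hs.le_hammingNorm_add_sum hG hy
    omega
  have hxn : hammingNorm (Matrix.vecMul x G) = d := by
    have := hs.hammingNorm_add_sum_eq hG hL hU
    omega
  have hinj : Function.Injective G.vecMulLinear := by
    rw [← LinearMap.ker_eq_bot, LinearMap.ker_eq_bot']
    intro y hy
    by_contra hy0
    have h1 := hge y hy0
    have h2 : Matrix.vecMul y G = 0 := hy
    rw [h2, hammingNorm_zero] at h1
    omega
  constructor
  · refine hasMinDist_iff.2 ⟨⟨Matrix.vecMul x G, ⟨x, rfl⟩, ?_, hxn⟩, ?_⟩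
    · intro h0
      rw [h0, hammingNorm_zero] at hxn
      omega
    · rintro _ ⟨y, rfl⟩ hy
      exact hge y (by rintro rfl; simp at hy)
  · rw [codeOf, LinearMap.finrank_range_of_inj hinj, Module.finrank_fin_fun]

theorem IsSunflower.exists_defect
    (hG : IsRepresentativeMatrix G {v | v ≠ 0 ∧ ∀ i ∈ I, v ∉ U i}) (hs : IsSunflower I U L a)
    {x : Fin k → F} (hL : ∀ v ∈ L, x ⬝ᵥ v = 0) (hU : ∀ i ∈ I, ∃ v ∈ U i, x ⬝ᵥ v ≠ 0)
    (hk : 3 ≤ k) (hI : I.card ≤ 3) (ha : ∀ i ∈ I, a i < k - 1)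
    (hcarry : ∀ j, ∑ i ∈ I with a i < j, Fintype.card F ^ a i < Fintype.card F ^ j) :
    ∃ d m : ℕ, 0 < d ∧ HasMinDist (codeOf G) d ∧ Module.finrank F (codeOf G) = k ∧
      IsLeast (cmValues F n d 2) m ∧ m + 2 ≤ k + max I.card 2 := by
  have hq : 1 < Fintype.card F := Fintype.one_lt_card
  -- At level k - 1 the no-carry condition says that the minimum distance is positive.
  have hlt := hcarry (k - 1)
  rw [filter_true_of_mem ha] at hlt
  obtain ⟨d, hd⟩ := Nat.exists_eq_add_of_lt hlt
  have hd' : d + 1 + ∑ i ∈ I, Fintype.card F ^ a i = Fintype.card F ^ (k - 1) := by omega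
  obtain ⟨hmin, hdim⟩ := hs.hasMinDist_and_finrank hG hL hU (Nat.succ_pos d) hd'
  have hlen := hs.length_add_sum hG
  have hgr := le_griesmerSum_add_sum (by omega) hd' (fun i hi => by have := ha i hi; omega) hcarry
  have hn : 3 ≤ n := by
    have h1 := hmin.griesmerSum_le hdim.ge
    have h2 := le_griesmerSum (q := Fintype.card F) (k := k) (by omega) (Nat.succ_pos d)
    omega
  have hkOpt : kOpt F (n - 3) (d + 1) + 4 ≤ k + max I.card 2 := kOpt_sub_three_le (F := F) (by omega) hn hI (Nat.succ_pos d)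
    (by omega) (show n + 1 ≤ griesmerSum (Fintype.card F) k (d + 1) + I.card by omega)
  have hmem : 2 + kOpt F (n - 3) (d + 1) ∈ cmValues F n (d + 1) 2 :=
    ⟨1, le_rfl, by omega, by simp⟩
  refine ⟨d + 1, sInf (cmValues F n (d + 1) 2), Nat.succ_pos d, hmin, hdim,
    ⟨Nat.sInf_mem ⟨_, hmem⟩, fun m hm => Nat.sInf_le hm⟩, ?_⟩
  have := Nat.sInf_le hmem
  omega

end Defect

/-! ### Coordinate subspaces and blocks of positions. -/

section Blocks

open Finset

/-- The vectors of `F ^ k` supported in `T`, as a span of standard basis vectors. -/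
def coordSubspace (F : Type*) [Field F] {k : ℕ} (T : Finset (Fin k)) : Submodule F (Fin k → F) :=
  Submodule.span F {v | ∃ j : Fin k, v = Pi.single j 1 ∧ j ∈ T}

variable {F : Type*} [Field F] {k : ℕ}

theorem mem_coordSubspace {T : Finset (Fin k)} {v : Fin k → F} :
    v ∈ coordSubspace F T ↔ ∀ j, j ∉ T → v j = 0 := by
  constructor
  · intro hv j hj
    induction hv using Submodule.span_induction with
    | mem v hv =>
      obtain ⟨l, rfl, hl⟩ := hv
      exact Pi.single_eq_of_ne (by rintro rfl; exact hj hl) _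
    | zero => rfl
    | add v w _ _ hv hw => simp [hv, hw]
    | smul c v _ hv => simp [hv]
  · intro hv
    rw [← (Pi.basisFun F (Fin k)).sum_repr v]
    refine Submodule.sum_mem _ fun j _ => ?_
    by_cases hj : j ∈ T
    · exact Submodule.smul_mem _ _ (Submodule.subset_span ⟨j, by simp, hj⟩)
    · simp [hv j hj]

theorem card_coordSubspace [Fintype F] (T : Finset (Fin k)) :
    Nat.card (coordSubspace F T) = Fintype.card F ^ T.card := by
  classical
  have h : coordSubspace F T =
      Submodule.span F (Set.range (Pi.basisFun F (Fin k) ∘ ((↑) : T → Fin k))) := by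
    unfold coordSubspace
    congr 1
    ext v
    simp only [Set.mem_ofPred_eq, Set.mem_range, Function.comp_apply, Pi.basisFun_apply,
      Subtype.exists]
    constructor
    · rintro ⟨j, rfl, hj⟩
      exact ⟨j, hj, rfl⟩
    · rintro ⟨j, hj, rfl⟩
      exact ⟨j, rfl, hj⟩
  have hfr : Module.finrank F (coordSubspace F T) = T.card := by
    rw [h, finrank_span_eq_card
      ((Pi.basisFun F (Fin k)).linearIndependent.comp _ Subtype.val_injective), Fintype.card_coe]
  rw [Nat.card_eq_fintype_card, Module.card_eq_pow_finrank (K := F), hfr]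

/-- The end of the `i`-th block of positions. -/
def blockEnd (u : ℕ → ℕ) (i : ℕ) : ℕ := u 0 + ∑ l ∈ Icc 1 i, (u l - u 0)

/-- The positions of the basis vectors that span the `i`-th block subspace. -/
def blockSupport (k : ℕ) (u : ℕ → ℕ) (i : ℕ) : Finset (Fin k) :=
  univ.filter fun j => (j : ℕ) < u 0 ∨ (blockEnd u (i - 1) ≤ (j : ℕ) ∧ (j : ℕ) < blockEnd u i)

theorem blockSubspace_eq (u : ℕ → ℕ) (i : ℕ) :
    blockSubspace F k u i = coordSubspace F (blockSupport k u i) := by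
  unfold blockSubspace coordSubspace blockSupport blockEnd
  simp only [mem_filter, mem_univ, true_and]

theorem blockEnd_mono (u : ℕ → ℕ) : Monotone (blockEnd u) := fun _ _ h =>
  Nat.add_le_add_left (sum_le_sum_of_subset (Icc_subset_Icc_right h)) _

theorem blockEnd_eq_add (u : ℕ → ℕ) {i : ℕ} (hi : 1 ≤ i) :
    blockEnd u i = blockEnd u (i - 1) + (u i - u 0) := by
  obtain ⟨i, rfl⟩ := Nat.exists_eq_add_of_le' hi
  simp [blockEnd, sum_Icc_succ_top, add_assoc]

theorem card_blockSupport {u : ℕ → ℕ} {i : ℕ} (hi : 1 ≤ i) (hk : blockEnd u i ≤ k) :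
    (blockSupport k u i).card = u 0 + (u i - u 0) := by
  have h0 : u 0 ≤ blockEnd u (i - 1) := Nat.le_add_right _ _
  have he := blockEnd_eq_add u hi
  have : (blockSupport k u i).map Fin.valEmbedding =
      range (u 0) ∪ Ico (blockEnd u (i - 1)) (blockEnd u i) := by
    ext m
    simp only [blockSupport, mem_map, mem_filter, mem_univ, true_and, Fin.valEmbedding_apply,
      mem_union, mem_range, mem_Ico]
    constructor
    · rintro ⟨j, hj, rfl⟩
      exact hj
    · intro hm
      exact ⟨⟨m, by omega⟩, hm, rfl⟩
  rw [← card_map Fin.valEmbedding, this, card_union_of_disjoint, card_range, Nat.card_Ico]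
  · omega
  · rw [disjoint_left]
    intro m hm hm'
    simp only [mem_range, mem_Ico] at hm hm'
    omega

end Blocks

/-! ### The block subspaces form a sunflower. -/

namespace AdmissibleParameters

open Finset

variable {q k h : ℕ} {u : ℕ → ℕ}

theorem u_one_le (hpar : AdmissibleParameters q k h u) {i : ℕ} (hi : 1 ≤ i) (hih : i ≤ h) :
    u 1 ≤ u i := by
  induction i, hi using Nat.le_induction with
  | base => exact le_rfl
  | succ i hi ih => exact (ih (by omega)).trans (hpar.u_le_succ i hi (by omega))

theorem u_zero_lt_of_mem (hpar : AdmissibleParameters q k h u) {i : ℕ} (hi : i ∈ Icc 1 h) :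
    u 0 < u i :=
  hpar.u_zero_lt.trans_le (hpar.u_one_le (mem_Icc.1 hi).1 (mem_Icc.1 hi).2)

theorem blockEnd_le (hpar : AdmissibleParameters q k h u) : blockEnd u h ≤ k := by
  have h1 := hpar.sum_le
  have h2 : ((∑ l ∈ Icc 1 h, (u l - u 0) : ℕ) : ℤ) =
      ∑ l ∈ Icc 1 h, (u l : ℤ) - (h : ℤ) * u 0 := by
    rw [Nat.cast_sum, sum_congr rfl fun l hl => Nat.cast_sub (hpar.u_zero_lt_of_mem hl).le,
      sum_sub_distrib]
    simp
  unfold blockEnd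
  zify
  rw [← Nat.cast_sum, h2]
  linarith

/-- Since h ≥ 2, some other block takes at least one further coordinate. -/
theorem sub_one_lt (hpar : AdmissibleParameters q k h u) (hu0 : u 0 = 1) {i : ℕ}
    (hi : i ∈ Icc 1 h) : u i - 1 < k - 1 := by
  have h1 := hpar.blockEnd_le
  have h2 := hpar.two_le_h
  rw [blockEnd, hu0, ← add_sum_erase _ _ hi] at h1
  obtain ⟨l, hl⟩ : ∃ l, l ∈ (Icc 1 h).erase i := by
    by_cases hi1 : i = 1
    · exact ⟨2, by simp [hi1, h2]⟩
    · exact ⟨1, by simp [Ne.symm hi1]; omega⟩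
  have h3 := single_le_sum (f := fun l => u l - 1) (fun _ _ => Nat.zero_le _) hl
  have h4 := hpar.u_zero_lt_of_mem (mem_of_mem_erase hl)
  omega

section Field

variable {F : Type*} [Field F] [Fintype F]

theorem isSunflower (hpar : AdmissibleParameters (Fintype.card F) k h u) (hu0 : u 0 = 1)
    (z : Fin k) (hz : (z : ℕ) = 0) :
    IsSunflower (Icc 1 h) (blockSubspace F k u) (coordSubspace F {z}) fun i => u i - 1 where
  nonempty := ⟨1, by have := hpar.two_le_h; simp; omega⟩
  card_core := by simp [card_coordSubspace]
  core_le := by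
    intro i _ v hv
    rw [blockSubspace_eq]
    rw [mem_coordSubspace] at hv ⊢
    intro j hj
    refine hv j fun hjz => hj ?_
    rw [mem_singleton.1 hjz]
    simp [blockSupport, hz, hu0]
  inf_le := by
    have key : ∀ i i' : ℕ, i < i' → blockSubspace F k u i ⊓ blockSubspace F k u i' ≤
        coordSubspace F {z} := by
      intro i i' hii v hv
      rw [Submodule.mem_inf, blockSubspace_eq, blockSubspace_eq, mem_coordSubspace,
        mem_coordSubspace] at hv
      rw [mem_coordSubspace]
      intro j hj
      by_contra hne
      have h1 : j ∈ blockSupport k u i := by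
        by_contra h
        exact hne (hv.1 j h)
      have h2 : j ∈ blockSupport k u i' := by
        by_contra h
        exact hne (hv.2 j h)
      have h3 : blockEnd u i ≤ blockEnd u (i' - 1) := blockEnd_mono u (by omega)
      have h4 : (j : ℕ) ≠ z := fun h => hj (mem_singleton.2 (Fin.ext h))
      simp only [blockSupport, mem_filter, mem_univ, true_and] at h1 h2
      omega
    intro i _ i' _ hii
    rcases lt_or_gt_of_ne hii with hlt | hlt
    · exact key i i' hlt
    · rw [inf_comm]
      exact key i' i hlt
  card_petal := by
    intro i hi
    have h1 := mem_Icc.1 hi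
    rw [blockSubspace_eq, card_coordSubspace, card_blockSupport h1.1
      ((blockEnd_mono u h1.2).trans hpar.blockEnd_le), hu0, add_comm]

theorem exists_dotProduct_ne_zero (hpar : AdmissibleParameters (Fintype.card F) k h u)
    (hu0 : u 0 = 1) (z : Fin k) (hz : (z : ℕ) = 0) :
    ∃ x : Fin k → F, (∀ v ∈ coordSubspace F {z}, x ⬝ᵥ v = 0) ∧
      ∀ i ∈ Icc 1 h, ∃ v ∈ blockSubspace F k u i, x ⬝ᵥ v ≠ 0 := by
  -- This x kills the core, and takes the value 1 on the first basis vector of each block.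
  refine ⟨fun j => if j = z then 0 else 1, fun v hv => ?_, fun i hi => ?_⟩
  · rw [mem_coordSubspace] at hv
    refine sum_eq_zero fun j _ => ?_
    by_cases hj : j = z
    · simp [hj]
    · simp [hv j (by simpa using hj)]
  · have h1 := mem_Icc.1 hi
    have h2 := blockEnd_eq_add u h1.1
    have h3 := hpar.u_zero_lt_of_mem hi
    have h4 := (blockEnd_mono u h1.2).trans hpar.blockEnd_le
    have h5 : u 0 ≤ blockEnd u (i - 1) := Nat.le_add_right _ _
    refine ⟨Pi.single ⟨blockEnd u (i - 1), by omega⟩ 1, ?_, ?_⟩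
    · rw [blockSubspace_eq]
      refine Submodule.subset_span ⟨_, rfl, ?_⟩
      simp only [blockSupport, mem_filter, mem_univ, true_and]
      omega
    · have : (⟨blockEnd u (i - 1), by omega⟩ : Fin k) ≠ z := by
        intro h
        have := congrArg Fin.val h
        simp only at this
        omega
      simp [this]

end Field

/-- Here w = 2^(u 1) + 2^(u 2) - 2, and `card_lt` gives only w ≤ 2^(k-1). Equality fails modulo 4: w
≡ 2 since both exponents are at least 2, while k ≥ 3 makes 4 divide 2^(k-1). -/
theorem two_mul_lt_of_two (hpar : AdmissibleParameters 2 k 2 u) (hu0 : u 0 = 1)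
    (hu : u 1 < u 2) {w : ℕ} (hw : w + 2 * 2 = 2 + ∑ i ∈ Icc 1 2, 2 ^ (u i - 1 + 1)) :
    2 * w < 2 ^ k := by
  have h1 := hpar.card_lt
  have h2 := hpar.u_zero_lt
  have h3 := hpar.blockEnd_le
  have e : Icc 1 2 = ({1, 2} : Finset ℕ) := rfl
  rw [hu0] at h1 h2
  rw [blockEnd, hu0] at h3
  simp only [e, sum_pair (show (1 : ℕ) ≠ 2 by norm_num)] at h1 h3 hw
  obtain ⟨a, ha⟩ := Nat.exists_eq_add_of_le (show 2 ≤ u 1 by omega)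
  obtain ⟨b, hb⟩ := Nat.exists_eq_add_of_le (show 2 ≤ u 2 by omega)
  obtain ⟨c, hc⟩ := Nat.exists_eq_add_of_le (show 3 ≤ k by omega)
  rw [ha, hb, hc] at h1
  rw [ha, hb] at hw
  rw [hc]
  rw [show 3 + c - 1 = 2 + c by omega] at h1
  rw [show 2 + a - 1 + 1 = 2 + a by omega, show 2 + b - 1 + 1 = 2 + b by omega] at hw
  simp only [pow_add] at h1 hw ⊢
  push_cast at h1
  zify at hw ⊢
  norm_num at h1 hw ⊢
  omega

end AdmissibleParameters

/-! ### The main theorem. -/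

theorem theorem4p3 {F : Type*} [Field F] [Fintype F] [DecidableEq F]
    (k h n : ℕ) (u : ℕ → ℕ)
    (hpar : AdmissibleParameters (Fintype.card F) k h u) (hu0 : u 0 = 1)
    (G : Matrix (Fin k) (Fin n) F)
    (hG : IsRepresentativeMatrix G (remainingVectors F k h u)) :
    (h = 2 → (3 ≤ Fintype.card F ∨ (Fintype.card F = 2 ∧ u 1 < u 2)) →
      IsLRC (codeOf G) 2 ∧ HasCMDefect (codeOf G) 2 0 ∧ IsOptimalLRC (codeOf G) 2) ∧
    (h = 3 → 4 ≤ Fintype.card F →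
      IsLRC (codeOf G) 2 ∧ ∃ δ : ℤ, HasCMDefect (codeOf G) 2 δ ∧ δ ≤ 1) := by
  classical
  have hk := hpar.three_le_k
  have hrem : remainingVectors F k h u =
      {v | v ≠ 0 ∧ ∀ i ∈ Finset.Icc 1 h, v ∉ blockSubspace F k u i} := by
    ext v
    simp [remainingVectors]
  rw [hrem] at hG
  have hs := hpar.isSunflower hu0 ⟨0, by omega⟩ rfl
  obtain ⟨x, hL, hU⟩ := hpar.exists_dotProduct_ne_zero hu0 ⟨0, by omega⟩ rfl
  have hI : (Finset.Icc 1 h).card = h := by simp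
  have hdefect := fun hh hcarry => hs.exists_defect hG hL hU hk hh
    (fun i hi => hpar.sub_one_lt hu0 hi) hcarry
  rw [hI] at hdefect
  constructor
  · rintro rfl hcase
    have hlrc : IsLRC (codeOf G) 2 := by
      rcases hcase with hq | ⟨hq, hu⟩
      · exact hs.isLRC_two_of_three_le_card hG hq
      · refine hs.isLRC_two_of_card_eq_two hG hq ?_
        have hcard := hs.card_union
        rw [hI, hq] at hcard
        rw [hq] at hpar
        exact hpar.two_mul_lt_of_two hu0 hu hcard
    -- No carries: two powers are fewer than q if q ≥ 3; for q = 2 the exponents must differ, which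
    -- is where u 1 < u 2 enters.
    obtain ⟨d, m, hd0, hmin, hdim, hm, hle⟩ := hdefect (by norm_num) (by
      rcases hcase with hq | ⟨hq, hu⟩
      · exact sum_pow_lt_pow_of_card_lt (by rw [hI]; omega)
      · rw [hq]
        have h1 := hpar.u_zero_lt
        refine sum_two_pow_lt_two_pow ?_
        intro i hi i' hi' hii
        simp only [Finset.coe_Icc, Set.mem_Icc] at hi hi' hii
        obtain ⟨hi1, hi2⟩ := hi
        obtain ⟨hi1', hi2'⟩ := hi'
        interval_cases i <;> interval_cases i' <;> omega)
    have hge := hlrc.finrank_le_of_mem_cmValues hd0 hmin hm.1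
    rw [hdim] at hge
    have hmk : m = k := by
      rw [max_self] at hle
      omega
    refine ⟨hlrc, ⟨d, m, hmin, hm, by rw [hdim, hmk, sub_self]⟩, hlrc, d, hmin, ?_⟩
    intro C' hC' hmin'
    rw [hdim, ← hmk]
    -- The CM values depend only on n, d and r, so m = k bounds every competitor.
    exact hC'.finrank_le_of_mem_cmValues hd0 hmin' hm.1
  · rintro rfl hq
    refine ⟨hs.isLRC_two_of_three_le_card hG (by omega), ?_⟩
    obtain ⟨d, m, -, hmin, hdim, hm, hle⟩ := hdefect le_rfl
      (sum_pow_lt_pow_of_card_lt (by rw [hI]; omega))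
    refine ⟨_, ⟨d, m, hmin, hm, rfl⟩, ?_⟩
    rw [hdim]
    have : max 3 2 = 3 := rfl
    omega
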